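/- Let $G=(V,E,\mu,w)$ be a connected, locally finite weighted graph with vertex measure $\mu:V\to(0,\infty)$ and symmetric edge weight $w$. Let $p(t,x,y)$ be its heat kernel, that is, the minimal nonnegative fundamental solution of $\partial_t u=\Delta u$, where $\Delta u(x)=\frac1{\mu(x)}\sum_{y\sim x}w_{xy}(u(y)-u(x))$, normalised by $p(0,x,x)\mu(x)=1$; equivalently, the increasing limit of the Dirichlet heat kernels of finite sets exhausting $V$. Assume that $G$ is stochastically complete, i.e. $\sum_{y\in V}p(t,x,y)\mu(y)=1$ for all $t>0$ and $x\in V$, and that $\inf_{x\in V}\mu(x)>0$. Let $s\in(0,1)$ and $p\in[2,+\infty)$. For $x\ne y$ put $$W_s(x,y)=\frac{s}{\Gamma(1-s)}\,\mu(x)\mu(y)\int_0^{+\infty}p(t,x,y)\,t^{-1-s}\,dt,$$ and for bounded $u:V\to\mathbb R$ put $$|\nabla^su|(x)=\Big(\frac1{2\mu(x)}\sum_{y\ne x}W_s(x,y)(u(x)-u(y))^2\Big)^{1/2}.$$ Let $W^{s,p}(V)$ be the set of all bounded $u:V\to\mathbb R$ for which $$\|u\|_{W^{s,p}(V)}=\Big(\sum_{x\in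 V}\mu(x)\big(|\nabla^su|^p(x)+|u(x)|^p\big)\Big)^{1/p}<+\infty .$$ Let $C_c(V)$ be the set of all finitely supported functions $V\to\mathbb R$, and let $W^{s,p}_0(V)$ be the completion of $C_c(V)$ under $\|\cdot\|_{W^{s,p}(V)}$, realised as the set of all $u\in W^{s,p}(V)$ for which there are $\varphi_n\in C_c(V)$ with $\|\varphi_n-u\|_{W^{s,p}(V)}\to0$. Then: (i) $W^{s,p}_0(V)$ is a linear space of functions that contains $C_c(V)$, and with the norm $\|\cdot\|_{W^{s,p}(V)}$ it is a reflexive Banach space; (ii) if $u\in W^{s,p}_0(V)$, then $u^+=\max\{u,0\}$, $u^-=\min\{u,0\}$ and $|u|$ also belong to $W^{s,p}_0(V)$. -/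

import Mathlib

open Filter Topology

noncomputable section

/-- A weighted graph `(V, E, μ, w)`: a simple graph on `V`, a symmetric weight that is positive
exactly on the edges, and a positive measure on the vertices. -/
structure WeightedGraph (V : Type*) where
  graph : SimpleGraph V
  weight : V → V → ℝ
  weight_symm : ∀ x y, weight x y = weight y x
  weight_pos : ∀ x y, graph.Adj x y → 0 < weight x y
  weight_eq_zero : ∀ x y, ¬ graph.Adj x y → weight x y = 0
  measure : V → ℝ
  measure_pos : ∀ x, 0 < measure x

namespace WeightedGraph

variable {V : Type*} (G : WeightedGraph V)

/-- Every vertex has finitely many neighbours. -/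
def IsLocallyFinite : Prop := ∀ x, (G.graph.neighborSet x).Finite

open scoped Classical in
/-- The matrix of the Dirichlet Laplacian on a finite set `U` of vertices, that is, of
`f ↦ Δ f = (1 / μ x) ∑ y, w x y * (f y - f x)` applied to functions `f` that vanish
outside `U` and then restricted to `U`. -/
def dirichletLaplacian (U : Finset V) : Matrix U U ℝ :=
  Matrix.of fun x y =>
    if x = y then -(∑' z : V, G.weight x z) / G.measure x else G.weight x y / G.measure x

open scoped Classical in
/-- The Dirichlet heat kernel of a finite set `U`, with respect to `μ` and extended by zero:
`p_U(t, x, y) = exp (t Δ_U) x y / μ y` for `x, y ∈ U`. -/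
def dirichletHeatKernel (U : Finset V) (t : ℝ) (x y : V) : ℝ :=
  if h : x ∈ U ∧ y ∈ U then
    (NormedSpace.exp (t • G.dirichletLaplacian U)) ⟨x, h.1⟩ ⟨y, h.2⟩ / G.measure y
  else 0

/-- The heat kernel `p(t, x, y)`, `t ≥ 0`, of the graph. It is obtained by exhaustion: for `t ≥ 0`
the Dirichlet heat kernels increase with `U` and are at most `1 / μ y`, so that the supremum is
their limit along every exhaustion of `V` by finite sets. -/
def heatKernel (t : ℝ) (x y : V) : ℝ := ⨆ U : Finset V, G.dirichletHeatKernel U t x y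

/-- Stochastic completeness: `∑ y, p(t, x, y) μ y = 1` for all `t > 0` and all `x`. -/
def IsStochasticallyComplete : Prop :=
  ∀ t : ℝ, 0 < t → ∀ x, HasSum (fun y => G.heatKernel t x y * G.measure y) 1

open scoped Classical in
/-- The kernel `W_s(x, y)`, extended by zero to the diagonal. -/
def fracKernel (s : ℝ) (x y : V) : ℝ :=
  if x = y then 0
  else s / Real.Gamma (1 - s) * G.measure x * G.measure y *
    ∫ t in Set.Ioi (0 : ℝ), G.heatKernel t x y * t ^ (-1 - s)

/-- The length `|∇ˢ u|(x)` of the fractional gradient. -/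
def fracGradLength (s : ℝ) (u : V → ℝ) (x : V) : ℝ :=
  Real.sqrt (1 / (2 * G.measure x) * ∑' y, G.fracKernel s x y * (u x - u y) ^ 2)

/-- The fractional Sobolev space `W^{s,p}(V)`: bounded functions `u` such that
`∫ (|∇ˢ u|^p + |u|^p) dμ` is finite. -/
def sobolevSpace (s p : ℝ) : Set (V → ℝ) :=
  {u | (∃ C : ℝ, ∀ x, |u x| ≤ C) ∧
    Summable fun x => (G.fracGradLength s u x ^ p + |u x| ^ p) * G.measure x}

/-- The norm of `W^{s,p}(V)`. -/
def sobolevNorm (s p : ℝ) (u : V → ℝ) : ℝ :=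
  (∑' x, (G.fracGradLength s u x ^ p + |u x| ^ p) * G.measure x) ^ (1 / p)

/-- The space `W₀^{s,p}(V)`, the completion of `C_c(V)` realised as a space of functions: all
limits in `W^{s,p}(V)` of sequences of finitely supported functions. -/
def sobolevSpaceZero (s p : ℝ) : Set (V → ℝ) :=
  {u | u ∈ G.sobolevSpace s p ∧
    ∃ φ : ℕ → V → ℝ, (∀ n, (φ n).support.Finite) ∧
      Tendsto (fun n => G.sobolevNorm s p (φ n - u)) atTop (𝓝 0)}

end WeightedGraph

/-- The function `N` is a norm on the real vector space `E`, and with this norm `E` is complete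
and reflexive (the canonical map into the bidual is onto). -/
def IsReflexiveBanachSpace (E : Type*) [AddCommGroup E] [Module ℝ E] (N : E → ℝ) : Prop :=
  letI : Norm E := ⟨N⟩
  ∃ core : NormedSpace.Core ℝ E,
    letI : NormedAddCommGroup E := NormedAddCommGroup.ofCore core
    letI : NormedSpace ℝ E := NormedSpace.ofCore core
    CompleteSpace E ∧ Function.Surjective (NormedSpace.inclusionInDoubleDual ℝ E)

end

/-!
For a bounded function `u` the fractional gradient at `x` is a vector in `ℓ²(V)` whose components
are multiples of `u x - u y` and whose norm is `|∇ˢ u|(x)`. Sending `u` to the family of pairs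
`μ x ^ (1 / p) • (∇ˢ u (x), u x)` therefore embeds `W^{s,p}(V)` isometrically and linearly into the
Banach space `ℓ^p(V; ℓ²(V) ×ₚ ℝ)` of jets. The range of the embedding is closed
(`HasSummableKernel.isClosed_range_toJet`), as gradients are determined by values and, by the lower
bound of `μ`, the sup norm is dominated by the Sobolev norm. So `W₀^{s,p}(V)` corresponds to a
closed subspace of the space of jets (`HasSummableKernel.jetClosure`).

For this one needs that the rows of `W_s` are summable (`summable_fracKernel`): the off-diagonal
mass of the heat kernel is `1 - p(t, x, x) μ x` by stochastic completeness, and this is at most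
`min 1 (C t)`, because the heat kernel dominates the Dirichlet heat kernel of `{x}`. Together with
the symmetry of `W_s`, the lower bound of `μ` and `p ≥ 2`, this also puts the finitely supported
functions into `W^{s,p}(V)` (`HasSummableKernel.mem_sobolevSubmodule_of_finite_support`).

Reflexivity: for `p ≥ 2`, Clarkson's inequality holds in inner product spaces and is inherited by
`p`-products, `ℓ^p`-sums and subspaces. It implies uniform convexity, and uniformly convex Banach
spaces are reflexive by the Milman–Pettis theorem
(`surjective_inclusionInDoubleDual_of_uniformConvexSpace`).

For the lattice operations let `ψ` be a contraction of `ℝ` that fixes `0`, and let `φ n → u` with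
finitely supported `φ n`. Norm convergence of `ψ ∘ φ n` is not clear, but these functions are
bounded in the reflexive space `W₀^{s,p}(V)`, so that they have a weak limit there. It is `ψ ∘ u`,
as point evaluations are continuous (`HasSummableKernel.comp_mem_sobolevSpaceZero`).
-/

-- The default within Mathlib, needed to find the instances on the bidual.
set_option maxSynthPendingDepth 3

/-! ### Uniformly convex Banach spaces are reflexive -/

section Reflexivity

variable {E : Type*} [NormedAddCommGroup E] [NormedSpace ℝ E]

/-- A weak form of Goldstine's theorem: an element of the unit ball of the bidual is approximated,
on any two functionals, by an element of the unit ball of the space. -/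
theorem exists_norm_le_one_abs_sub_lt_of_bidual
    (Φ : StrongDual ℝ (StrongDual ℝ E)) (hΦ : ‖Φ‖ ≤ 1) (f g : StrongDual ℝ E) {η : ℝ}
    (hη : 0 < η) : ∃ x : E, ‖x‖ ≤ 1 ∧ |f x - Φ f| < η ∧ |g x - Φ g| < η := by
  set s : Set (ℝ × ℝ) := closure ((f.prod g) '' Metric.closedBall 0 1) with hs
  have hconv : Convex ℝ s :=
    ((convex_closedBall (0 : E) 1).linear_image (f.prod g : E →ₗ[ℝ] ℝ × ℝ)).closure
  have hmem : (Φ f, Φ g) ∈ s := by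
    by_contra hnot
    obtain ⟨l, u, hl, hu⟩ := geometric_hahn_banach_closed_point hconv isClosed_closure hnot
    have hlab : ∀ a b : ℝ, l (a, b) = a * l (1, 0) + b * l (0, 1) := by
      intro a b
      have : ((a, b) : ℝ × ℝ) = a • (1, 0) + b • (0, 1) := by simp
      rw [this, map_add, map_smul, map_smul, smul_eq_mul, smul_eq_mul]
    set h : StrongDual ℝ E := l (1, 0) • f + l (0, 1) • g with hh
    have hle : ∀ z : E, ‖z‖ ≤ 1 → h z < u := by
      intro z hz
      have h1 := hl (f z, g z) (subset_closure ⟨z, by simpa using hz, rfl⟩)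
      rw [hlab] at h1
      simp only [hh, add_apply, smul_apply, smul_eq_mul]
      linarith
    have hΦh : u < Φ h := by
      rw [hlab] at hu
      simp only [hh, map_add, map_smul, smul_eq_mul]
      linarith
    have hnorm : u < ‖h‖ := by
      have h1 := (le_abs_self _).trans (Φ.le_opNorm h)
      nlinarith [norm_nonneg h]
    obtain ⟨z, hz, hz'⟩ := h.exists_lt_apply_of_lt_opNorm hnorm
    rw [Real.norm_eq_abs] at hz'
    rcases lt_abs.1 hz' with h1 | h1
    · exact (hle z hz.le).not_gt h1
    · exact (hle (-z) (by simpa using hz.le)).not_gt (by simpa using h1)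
  obtain ⟨_, ⟨x, hx, rfl⟩, hd⟩ := Metric.mem_closure_iff.1 hmem η hη
  rw [dist_comm, Prod.dist_eq, max_lt_iff] at hd
  exact ⟨x, by simpa using hx, hd.1, hd.2⟩

/-- An element of norm one of the bidual of a uniformly convex space is a limit of elements of the
space. If `Φ f` is close to `1` with `‖f‖ ≤ 1`, then all points `z` of the unit ball with `f z`
close to `1` are close to each other, and among them are points that approximate `Φ` on any further
functional `g`. -/
theorem exists_norm_bidual_sub_le [UniformConvexSpace E]
    (Φ : StrongDual ℝ (StrongDual ℝ E)) (hΦ : ‖Φ‖ = 1) {ε : ℝ} (hε : 0 < ε) :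
    ∃ x : E, ‖Φ - NormedSpace.inclusionInDoubleDual ℝ E x‖ ≤ ε := by
  obtain ⟨δ, hδ, hUC⟩ := exists_forall_closed_ball_dist_add_le_two_sub E hε
  obtain ⟨f, hf, hΦf⟩ : ∃ f : StrongDual ℝ E, ‖f‖ ≤ 1 ∧ 1 - δ / 4 < Φ f := by
    obtain ⟨f, hf, hf'⟩ := Φ.exists_lt_apply_of_lt_opNorm (r := 1 - δ / 4) (by linarith)
    rw [Real.norm_eq_abs] at hf'
    rcases lt_abs.1 hf' with h1 | h1
    · exact ⟨f, hf.le, h1⟩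
    · exact ⟨-f, by simpa using hf.le, by simpa using h1⟩
  obtain ⟨x, hx, hfx, -⟩ :=
    exists_norm_le_one_abs_sub_lt_of_bidual Φ hΦ.le f f (η := δ / 4) (by linarith)
  refine ⟨x, ContinuousLinearMap.opNorm_le_bound _ hε.le fun g => ?_⟩
  refine le_of_forall_pos_le_add fun η hη => ?_
  obtain ⟨z, hz, hfz, hgz⟩ := exists_norm_le_one_abs_sub_lt_of_bidual Φ hΦ.le f g
    (η := min η (δ / 4)) (lt_min hη (by linarith))
  have hfz' := hfz.trans_le (min_le_right _ _)
  have hgz' := hgz.trans_le (min_le_left _ _)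
  have hzx : ‖z - x‖ ≤ ε := by
    by_contra hlt
    have h1 := hUC hz hx (not_le.1 hlt).le
    have h2 : f (z + x) ≤ ‖z + x‖ := by
      have := (le_abs_self _).trans (f.le_opNorm (z + x))
      nlinarith [norm_nonneg (z + x)]
    rw [map_add] at h2
    linarith [(abs_lt.1 hfx).1, (abs_lt.1 hfz').1]
  have h3 : |g (z - x)| ≤ ε * ‖g‖ := by
    refine (g.le_opNorm (z - x)).trans ?_
    rw [mul_comm]
    exact mul_le_mul_of_nonneg_right hzx (norm_nonneg g)
  rw [map_sub] at h3
  rw [sub_apply, NormedSpace.dual_def, Real.norm_eq_abs]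
  have h4 : Φ g - g x = -(g z - Φ g) + (g z - g x) := by ring
  rw [h4]
  refine (abs_add_le _ _).trans ?_
  rw [abs_neg]
  linarith

/-- The Milman–Pettis theorem: a uniformly convex Banach space is reflexive. -/
theorem surjective_inclusionInDoubleDual_of_uniformConvexSpace [UniformConvexSpace E]
    [CompleteSpace E] : Function.Surjective (NormedSpace.inclusionInDoubleDual ℝ E) := by
  have hclosed : IsClosed (Set.range (NormedSpace.inclusionInDoubleDual ℝ E)) := by
    have h := (NormedSpace.inclusionInDoubleDualLi (E := E) ℝ).isometry.isClosedEmbedding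
    exact h.isClosed_range
  have hunit : ∀ Φ : StrongDual ℝ (StrongDual ℝ E), ‖Φ‖ = 1 →
      ∃ x, NormedSpace.inclusionInDoubleDual ℝ E x = Φ := by
    intro Φ hΦ
    have : Φ ∈ closure (Set.range (NormedSpace.inclusionInDoubleDual ℝ E)) := by
      refine Metric.mem_closure_iff.2 fun ε hε => ?_
      obtain ⟨x, hx⟩ := exists_norm_bidual_sub_le Φ hΦ (half_pos hε)
      exact ⟨_, ⟨x, rfl⟩, by rw [dist_eq_norm]; linarith⟩
    rwa [hclosed.closure_eq] at this
  intro Φ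
  by_cases h0 : Φ = 0
  · exact ⟨0, by rw [h0, map_zero]⟩
  · obtain ⟨x, hx⟩ := hunit (‖Φ‖⁻¹ • Φ) (by
      rw [norm_smul, norm_inv, norm_norm, inv_mul_cancel₀ (norm_ne_zero_iff.2 h0)])
    refine ⟨‖Φ‖ • x, ?_⟩
    rw [map_smul, hx, smul_smul, mul_inv_cancel₀ (norm_ne_zero_iff.2 h0), one_smul]

/-- In a reflexive space every bounded sequence converges weakly along some ultrafilter. -/
theorem exists_ultrafilter_tendsto_of_reflexive
    (hE : Function.Surjective (NormedSpace.inclusionInDoubleDual ℝ E)) {v : ℕ → E} {C : ℝ}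
    (hv : ∀ n, ‖v n‖ ≤ C) :
    ∃ (w : E) (𝒰 : Ultrafilter ℕ), (𝒰 : Filter ℕ) ≤ atTop ∧
      ∀ f : StrongDual ℝ E, Tendsto (fun n => f (v n)) 𝒰 (𝓝 (f w)) := by
  set 𝒰 : Ultrafilter ℕ := Ultrafilter.of atTop with h𝒰
  have hlim : ∀ f : StrongDual ℝ E, ∃ a : ℝ, Tendsto (fun n => f (v n)) 𝒰 (𝓝 a) := by
    intro f
    obtain ⟨a, -, ha⟩ := (isCompact_closedBall (0 : ℝ) (‖f‖ * C)).ultrafilter_le_nhds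
      (𝒰.map fun n => f (v n)) (by
        refine Filter.tendsto_principal.2 ?_
        refine Filter.Eventually.of_forall fun n => ?_
        rw [mem_closedBall_zero_iff]
        exact (f.le_opNorm _).trans (mul_le_mul_of_nonneg_left (hv n) (norm_nonneg f)))
    exact ⟨a, ha⟩
  choose L hL using hlim
  let Λ : StrongDual ℝ E →ₗ[ℝ] ℝ :=
    { toFun := L
      map_add' := fun f g => tendsto_nhds_unique (hL (f + g)) ((hL f).add (hL g))
      map_smul' := fun c f => tendsto_nhds_unique (hL (c • f)) ((hL f).const_mul c) }
  have hΛ : ∀ f, ‖Λ f‖ ≤ C * ‖f‖ := by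
    intro f
    refine le_of_tendsto (hL f).norm (Filter.Eventually.of_forall fun n => ?_)
    rw [mul_comm]
    exact (f.le_opNorm _).trans (mul_le_mul_of_nonneg_left (hv n) (norm_nonneg f))
  obtain ⟨w, hw⟩ := hE (Λ.mkContinuous C hΛ)
  refine ⟨w, 𝒰, Ultrafilter.of_le _, fun f => ?_⟩
  have h1 : f w = L f := by
    rw [← NormedSpace.dual_def ℝ E w f, hw]
    rfl
  rw [h1]
  exact hL f

end Reflexivity

/-! ### Clarkson's inequality -/

section Clarkson

/-- Clarkson's inequality with exponent `p` in a normed group. -/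
def ClarksonIneq (E : Type*) [NormedAddCommGroup E] (p : ℝ) : Prop :=
  ∀ x y : E, ‖x + y‖ ^ p + ‖x - y‖ ^ p ≤ 2 ^ (p - 1) * (‖x‖ ^ p + ‖y‖ ^ p)

/-- Clarkson's inequality bounds `‖x + y‖ ^ p` by `2 ^ p - ‖x - y‖ ^ p` on the unit sphere. -/
theorem ClarksonIneq.uniformConvexSpace {E : Type*} [NormedAddCommGroup E]
    {p : ℝ} (hp : 0 < p) (h : ClarksonIneq E p) : UniformConvexSpace E where
  uniform_convex ε hε := by
    set e := min ε 1 with he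
    have he0 : 0 < e := lt_min hε one_pos
    have hep : 0 < e ^ p := Real.rpow_pos_of_pos he0 p
    have h2p : e ^ p ≤ 2 ^ p :=
      Real.rpow_le_rpow he0.le ((min_le_right _ _).trans one_le_two) hp.le
    refine ⟨2 - (2 ^ p - e ^ p) ^ (1 / p), ?_, fun x hx y hy hxy => ?_⟩
    · have h1 : (2 ^ p - e ^ p) ^ (1 / p) < ((2 : ℝ) ^ p) ^ (1 / p) :=
        Real.rpow_lt_rpow (by linarith) (by linarith) (by positivity)
      rw [← Real.rpow_mul zero_le_two, mul_one_div_cancel hp.ne', Real.rpow_one] at h1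
      linarith
    · have h1 := h x y
      rw [hx, hy, Real.one_rpow, Real.rpow_sub_one two_ne_zero] at h1
      have h2 : e ^ p ≤ ‖x - y‖ ^ p :=
        Real.rpow_le_rpow he0.le ((min_le_left _ _).trans hxy) hp.le
      have h3 : ‖x + y‖ ^ p ≤ 2 ^ p - e ^ p := by linarith
      have h4 := Real.rpow_le_rpow (by positivity) h3 (by positivity : 0 ≤ 1 / p)
      rw [← Real.rpow_mul (norm_nonneg _), mul_one_div_cancel hp.ne', Real.rpow_one] at h4
      linarith

/-- Clarkson's inequality in an inner product space follows from the parallelogram law, the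
superadditivity of `t ↦ t ^ (p / 2)` and its convexity. -/
theorem clarksonIneq_of_innerProductSpace {H : Type*} [NormedAddCommGroup H]
    [InnerProductSpace ℝ H] {p : ℝ} (hp : 2 ≤ p) : ClarksonIneq H p := by
  intro x y
  have hq : 1 ≤ p / 2 := by linarith
  have hsq : ∀ a : ℝ, 0 ≤ a → a ^ p = (a ^ 2) ^ (p / 2) := by
    intro a ha
    rw [← Real.rpow_natCast_mul ha]
    congr 1
    push_cast
    ring
  rw [hsq _ (norm_nonneg (x + y)), hsq _ (norm_nonneg (x - y)), hsq _ (norm_nonneg x),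
    hsq _ (norm_nonneg y)]
  have hpar : ‖x + y‖ ^ 2 + ‖x - y‖ ^ 2 = 2 * (‖x‖ ^ 2 + ‖y‖ ^ 2) := by
    have := parallelogram_law_with_norm ℝ x y
    nlinarith
  have h1 : (‖x + y‖ ^ 2) ^ (p / 2) + (‖x - y‖ ^ 2) ^ (p / 2) ≤
      (‖x + y‖ ^ 2 + ‖x - y‖ ^ 2) ^ (p / 2) := by
    have := NNReal.add_rpow_le_rpow_add (p := p / 2) (‖x + y‖₊ ^ 2) (‖x - y‖₊ ^ 2) hq
    rw [← NNReal.coe_le_coe] at this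
    push_cast at this
    exact this
  have h2 : (‖x‖ ^ 2 + ‖y‖ ^ 2) ^ (p / 2) ≤
      2 ^ (p / 2 - 1) * ((‖x‖ ^ 2) ^ (p / 2) + (‖y‖ ^ 2) ^ (p / 2)) := by
    have := NNReal.rpow_add_le_mul_rpow_add_rpow (p := p / 2) (‖x‖₊ ^ 2) (‖y‖₊ ^ 2) hq
    rw [← NNReal.coe_le_coe] at this
    push_cast at this
    exact this
  rw [hpar, Real.mul_rpow zero_le_two (by positivity)] at h1
  refine h1.trans ((mul_le_mul_of_nonneg_left h2 (by positivity)).trans (le_of_eq ?_))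
  rw [← mul_assoc, ← Real.rpow_add zero_lt_two]
  congr 2
  ring

variable {p : ℝ}

/-- Clarkson's inequality passes to `p`-products. -/
theorem ClarksonIneq.withLp {q : ENNReal} [Fact (1 ≤ q)] (hq : 0 < q.toReal) {E F : Type*}
    [NormedAddCommGroup E] [NormedAddCommGroup F] (hE : ClarksonIneq E q.toReal)
    (hF : ClarksonIneq F q.toReal) : ClarksonIneq (WithLp q (E × F)) q.toReal := by
  have hnorm : ∀ z : WithLp q (E × F),
      ‖z‖ ^ q.toReal = ‖z.fst‖ ^ q.toReal + ‖z.snd‖ ^ q.toReal := by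
    intro z
    rw [WithLp.prod_norm_eq_add hq, ← Real.rpow_mul (by positivity), one_div_mul_cancel hq.ne',
      Real.rpow_one]
  intro x y
  simp only [hnorm, WithLp.add_fst, WithLp.add_snd, WithLp.sub_fst, WithLp.sub_snd]
  linarith [hE x.fst y.fst, hF x.snd y.snd]

/-- Clarkson's inequality passes to `ℓ^p`-sums. -/
theorem ClarksonIneq.lp {q : ENNReal} [Fact (1 ≤ q)] (hq : 0 < q.toReal) {ι : Type*}
    {E : ι → Type*} [∀ i, NormedAddCommGroup (E i)] (hE : ∀ i, ClarksonIneq (E i) q.toReal) :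
    ClarksonIneq (lp E q) q.toReal := by
  intro x y
  refine hasSum_le (fun i => ?_) ((lp.hasSum_norm hq (x + y)).add (lp.hasSum_norm hq (x - y)))
    (((lp.hasSum_norm hq x).add (lp.hasSum_norm hq y)).mul_left _)
  simpa using! hE i (x i) (y i)

theorem ClarksonIneq.of_isometry {E F : Type*} [NormedAddCommGroup E] [NormedAddCommGroup F]
    (hF : ClarksonIneq F p) (T : E →+ F) (hT : ∀ x, ‖T x‖ = ‖x‖) : ClarksonIneq E p := by
  intro x y
  simpa only [← map_add, ← map_sub, hT] using hF (T x) (T y)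

end Clarkson

/-! ### Exponentials of matrices with nonnegative off-diagonal entries -/

section MatrixExp

variable {ι : Type*} [Fintype ι] [DecidableEq ι]

theorem Matrix.hasSum_exp_apply (A : Matrix ι ι ℝ) (i j : ι) :
    HasSum (fun n : ℕ => (n.factorial : ℝ)⁻¹ * (A ^ n) i j) (NormedSpace.exp A i j) := by
  let : NormedRing (Matrix ι ι ℝ) := Matrix.linftyOpNormedRing
  let : NormedAlgebra ℝ (Matrix ι ι ℝ) := Matrix.linftyOpNormedAlgebra
  have h := NormedSpace.exp_series_hasSum_exp' (𝕂 := ℝ) A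
  exact Pi.hasSum.1 (Pi.hasSum.1 h i) j

theorem Matrix.exp_add_smul_one_apply (A : Matrix ι ι ℝ) (c : ℝ) (i j : ι) :
    NormedSpace.exp (A + c • (1 : Matrix ι ι ℝ)) i j =
      Real.exp c * NormedSpace.exp A i j := by
  rw [Matrix.exp_add_of_commute _ _ ((Commute.one_right A).smul_right c), Matrix.smul_one_eq_diagonal,
    Matrix.exp_diagonal, Matrix.mul_diagonal, mul_comm, Pi.coe_exp, Real.exp_eq_exp_ℝ]

theorem Matrix.sum_pow_apply_le {A : Matrix ι ι ℝ} (hA : ∀ i j, 0 ≤ A i j) {c : ℝ}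
    (hc : ∀ i, ∑ j, A i j ≤ c) (n : ℕ) (i : ι) : ∑ j, (A ^ n) i j ≤ c ^ n := by
  have hc0 : 0 ≤ c := (Finset.sum_nonneg fun j _ => hA i j).trans (hc i)
  induction n with
  | zero => simp [Matrix.one_apply]
  | succ n ih =>
    calc ∑ j, (A ^ (n + 1)) i j = ∑ k, (A ^ n) i k * ∑ j, A k j := by
          simp_rw [pow_succ, Matrix.mul_apply, Finset.mul_sum]
          exact Finset.sum_comm
      _ ≤ ∑ k, (A ^ n) i k * c := Finset.sum_le_sum fun k _ =>
          mul_le_mul_of_nonneg_left (hc k) (Matrix.pow_apply_nonneg hA n i k)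
      _ = (∑ k, (A ^ n) i k) * c := (Finset.sum_mul _ _ _).symm
      _ ≤ c ^ n * c := mul_le_mul_of_nonneg_right ih hc0
      _ = c ^ (n + 1) := (pow_succ c n).symm

/-- The exponential of a generator of a sub-Markovian semigroup is a sub-Markovian matrix. Adding
a large multiple `c` of the identity makes all entries nonnegative and only multiplies the
exponential by `exp c`. -/
theorem Matrix.exp_subMarkov {A : Matrix ι ι ℝ} (hoff : ∀ i j, i ≠ j → 0 ≤ A i j)
    (hrow : ∀ i, ∑ j, A i j ≤ 0) :
    (∀ i j, 0 ≤ NormedSpace.exp A i j) ∧ ∀ i, ∑ j, NormedSpace.exp A i j ≤ 1 := by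
  set c : ℝ := ∑ i, |A i i| with hc
  set B : Matrix ι ι ℝ := A + c • (1 : Matrix ι ι ℝ) with hB
  have hBnonneg : ∀ i j, 0 ≤ B i j := by
    intro i j
    rcases eq_or_ne i j with rfl | hij
    · have h1 : |A i i| ≤ c :=
        Finset.single_le_sum (f := fun i => |A i i|) (fun _ _ => abs_nonneg _) (Finset.mem_univ i)
      have h2 := neg_abs_le (A i i)
      simp only [hB, Matrix.add_apply, Matrix.smul_apply, Matrix.one_apply_eq, smul_eq_mul]
      linarith
    · simpa [hB, Matrix.one_apply_ne hij] using hoff i j hij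
  have hBrow : ∀ i, ∑ j, B i j ≤ c := by
    intro i
    have : ∑ j, B i j = ∑ j, A i j + c := by
      simp [hB, Finset.sum_add_distrib, Matrix.one_apply]
    linarith [hrow i]
  have hexp : ∀ i j, NormedSpace.exp B i j = Real.exp c * NormedSpace.exp A i j :=
    Matrix.exp_add_smul_one_apply A c
  refine ⟨fun i j => ?_, fun i => ?_⟩
  · have h1 : 0 ≤ NormedSpace.exp B i j := (Matrix.hasSum_exp_apply B i j).nonneg fun n =>
      mul_nonneg (by positivity) (Matrix.pow_apply_nonneg hBnonneg n i j)
    rw [hexp] at h1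
    exact nonneg_of_mul_nonneg_right h1 (Real.exp_pos c)
  · have h1 : HasSum (fun n : ℕ => (n.factorial : ℝ)⁻¹ * ∑ j, (B ^ n) i j)
        (∑ j, NormedSpace.exp B i j) := by
      simp_rw [Finset.mul_sum]
      exact hasSum_sum fun j _ => Matrix.hasSum_exp_apply B i j
    have h2 : HasSum (fun n : ℕ => (n.factorial : ℝ)⁻¹ * c ^ n) (Real.exp c) := by
      have := NormedSpace.exp_series_hasSum_exp' (𝕂 := ℝ) c
      simpa [Real.exp_eq_exp_ℝ] using this
    have h3 := hasSum_le (fun n => mul_le_mul_of_nonneg_left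
      (Matrix.sum_pow_apply_le hBnonneg hBrow n i) (by positivity)) h1 h2
    simp_rw [hexp, ← Finset.mul_sum] at h3
    exact (mul_le_iff_le_one_right (Real.exp_pos c)).1 h3

/-- If a matrix is symmetric with respect to the weight `m`, so is its exponential. -/
theorem Matrix.mul_exp_apply_comm {A : Matrix ι ι ℝ} {m : ι → ℝ}
    (h : ∀ i j, m i * A i j = m j * A j i) (i j : ι) :
    m i * NormedSpace.exp A i j = m j * NormedSpace.exp A j i := by
  have hpow : ∀ (n : ℕ) (i j : ι), m i * (A ^ n) i j = m j * (A ^ n) j i := by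
    intro n
    induction n with
    | zero =>
      intro i j
      rcases eq_or_ne i j with rfl | hij
      · rfl
      · simp [Matrix.one_apply_ne hij, Matrix.one_apply_ne hij.symm]
    | succ n ih =>
      intro i j
      rw [pow_succ, Matrix.mul_apply, ← pow_succ, pow_succ', Matrix.mul_apply, Finset.mul_sum,
        Finset.mul_sum]
      refine Finset.sum_congr rfl fun k _ => ?_
      rw [← mul_assoc, ih i k, ← mul_assoc, h j k]
      ring
  refine ((Matrix.hasSum_exp_apply A i j).mul_left (m i)).unique ?_
  convert (Matrix.hasSum_exp_apply A j i).mul_left (m j) using 2 with n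
  linear_combination (n.factorial : ℝ)⁻¹ * hpow n i j

end MatrixExp

namespace WeightedGraph

variable {V : Type*} (G : WeightedGraph V)

/-! ### The heat kernel -/

theorem weight_nonneg (x y : V) : 0 ≤ G.weight x y := by
  by_cases h : G.graph.Adj x y
  · exact (G.weight_pos x y h).le
  · exact (G.weight_eq_zero x y h).ge

variable {G}

theorem IsLocallyFinite.summable_weight (hfin : G.IsLocallyFinite) (x : V) :
    Summable (G.weight x) :=
  summable_of_hasFiniteSupport ((hfin x).subset fun y hy => by
    by_contra h
    exact hy (G.weight_eq_zero x y h))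

variable (G) in
open scoped Classical in
theorem dirichletLaplacian_subMarkov (hfin : G.IsLocallyFinite) (U : Finset V) :
    (∀ i j, i ≠ j → 0 ≤ G.dirichletLaplacian U i j) ∧
      ∀ i, ∑ j, G.dirichletLaplacian U i j ≤ 0 := by
  refine ⟨fun i j hij => ?_, fun i => ?_⟩
  · simp only [dirichletLaplacian, Matrix.of_apply, if_neg hij]
    exact div_nonneg (G.weight_nonneg _ _) (G.measure_pos _).le
  · have h1 : ∑ j, G.dirichletLaplacian U i j ≤
        ∑ j : U, ((if i = j then -(∑' z : V, G.weight i z) / G.measure i else 0) +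
          G.weight i j / G.measure i) := by
      refine Finset.sum_le_sum fun j _ => ?_
      have := div_nonneg (G.weight_nonneg i j) (G.measure_pos i).le
      simp only [dirichletLaplacian, Matrix.of_apply]
      split_ifs <;> linarith
    refine h1.trans ?_
    rw [Finset.sum_add_distrib, Finset.sum_ite_eq, if_pos (Finset.mem_univ _), ← Finset.sum_div,
      ← add_div]
    refine div_nonpos_of_nonpos_of_nonneg ?_ (G.measure_pos _).le
    have h2 : ∑ j : U, G.weight i j = ∑ j ∈ U, G.weight i j := Finset.sum_coe_sort U (G.weight i)
    have h3 := (hfin.summable_weight (i : V)).sum_le_tsum U fun j _ => G.weight_nonneg i j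
    rw [h2]
    linarith

open scoped Classical in
theorem exp_dirichletLaplacian_subMarkov (hfin : G.IsLocallyFinite) (U : Finset V) {t : ℝ}
    (ht : 0 ≤ t) :
    (∀ i j, 0 ≤ NormedSpace.exp (t • G.dirichletLaplacian U) i j) ∧
      ∀ i, ∑ j, NormedSpace.exp (t • G.dirichletLaplacian U) i j ≤ 1 := by
  obtain ⟨h1, h2⟩ := G.dirichletLaplacian_subMarkov hfin U
  refine Matrix.exp_subMarkov (fun i j hij => ?_) fun i => ?_
  · exact mul_nonneg ht (h1 i j hij)
  · simp only [Matrix.smul_apply, ← Finset.smul_sum]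
    exact mul_nonpos_of_nonneg_of_nonpos ht (h2 i)

theorem dirichletHeatKernel_nonneg (hfin : G.IsLocallyFinite) (U : Finset V) {t : ℝ}
    (ht : 0 ≤ t) (x y : V) : 0 ≤ G.dirichletHeatKernel U t x y := by
  unfold dirichletHeatKernel
  split_ifs with h
  · exact div_nonneg ((exp_dirichletLaplacian_subMarkov hfin U ht).1 _ _) (G.measure_pos y).le
  · exact le_rfl

theorem dirichletHeatKernel_le (hfin : G.IsLocallyFinite) (U : Finset V) {t : ℝ}
    (ht : 0 ≤ t) (x y : V) : G.dirichletHeatKernel U t x y ≤ 1 / G.measure y := by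
  unfold dirichletHeatKernel
  split_ifs with h
  · obtain ⟨h1, h2⟩ := exp_dirichletLaplacian_subMarkov hfin U ht
    exact div_le_div_of_nonneg_right ((Finset.single_le_sum (fun j _ => h1 ⟨x, h.1⟩ j)
      (Finset.mem_univ (⟨y, h.2⟩ : U))).trans (h2 _)) (G.measure_pos y).le
  · exact one_div_nonneg.2 (G.measure_pos y).le

variable (G) in
theorem dirichletHeatKernel_symm (U : Finset V) (t : ℝ) (x y : V) :
    G.dirichletHeatKernel U t x y = G.dirichletHeatKernel U t y x := by
  classical
  unfold dirichletHeatKernel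
  by_cases h : x ∈ U ∧ y ∈ U
  · rw [dif_pos h, dif_pos h.symm, div_eq_div_iff (G.measure_pos y).ne' (G.measure_pos x).ne',
      mul_comm, mul_comm _ (G.measure y)]
    refine Matrix.mul_exp_apply_comm (m := fun i : U => G.measure i) (fun i j => ?_)
      ⟨x, h.1⟩ ⟨y, h.2⟩
    have hi := (G.measure_pos i).ne'
    have hj := (G.measure_pos j).ne'
    rcases eq_or_ne i j with rfl | hij
    · rfl
    · simp only [dirichletLaplacian, Matrix.smul_apply, Matrix.of_apply, if_neg hij,
        if_neg hij.symm, smul_eq_mul, G.weight_symm j i]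
      field_simp
  · rw [dif_neg h, dif_neg fun h' => h h'.symm]

variable (G) in
theorem dirichletHeatKernel_singleton (t : ℝ) (x : V) :
    G.dirichletHeatKernel {x} t x x =
      Real.exp (-(t * ((∑' z, G.weight x z) / G.measure x))) / G.measure x := by
  classical
  have hx : x ∈ ({x} : Finset V) := Finset.mem_singleton_self x
  unfold dirichletHeatKernel
  rw [dif_pos ⟨hx, hx⟩]
  congr 1
  have h1 : t • G.dirichletLaplacian {x} =
      Matrix.diagonal fun _ => -(t * ((∑' z, G.weight x z) / G.measure x)) := by
    ext i j
    have hi : (i : V) = x := Finset.mem_singleton.1 i.2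
    have hij : i = j := Subtype.ext (hi.trans (Finset.mem_singleton.1 j.2).symm)
    subst hij
    simp only [dirichletLaplacian, Matrix.smul_apply, Matrix.of_apply, if_true, smul_eq_mul,
      Matrix.diagonal_apply_eq, hi]
    ring
  rw [h1, Matrix.exp_diagonal, Matrix.diagonal_apply_eq, Pi.coe_exp, Real.exp_eq_exp_ℝ]

theorem bddAbove_dirichletHeatKernel (hfin : G.IsLocallyFinite) {t : ℝ} (ht : 0 ≤ t) (x y : V) :
    BddAbove (Set.range fun U : Finset V => G.dirichletHeatKernel U t x y) :=
  ⟨1 / G.measure y, by rintro _ ⟨U, rfl⟩; exact dirichletHeatKernel_le hfin U ht x y⟩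

theorem heatKernel_nonneg (hfin : G.IsLocallyFinite) {t : ℝ} (ht : 0 ≤ t) (x y : V) :
    0 ≤ G.heatKernel t x y :=
  Real.iSup_nonneg fun U => dirichletHeatKernel_nonneg hfin U ht x y

variable (G) in
theorem heatKernel_symm (t : ℝ) (x y : V) : G.heatKernel t x y = G.heatKernel t y x :=
  iSup_congr fun U => G.dirichletHeatKernel_symm U t x y

/-- The probability of not having left `x` up to time `t` bounds the diagonal heat kernel. -/
theorem exp_le_heatKernel_mul_measure (hfin : G.IsLocallyFinite) {t : ℝ} (ht : 0 ≤ t) (x : V) :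
    Real.exp (-(t * ((∑' z, G.weight x z) / G.measure x))) ≤
      G.heatKernel t x x * G.measure x := by
  rw [← div_le_iff₀ (G.measure_pos x), ← G.dirichletHeatKernel_singleton]
  exact le_ciSup (bddAbove_dirichletHeatKernel hfin ht x x) {x}

/-- Off the diagonal the heat kernel is `O(t)` at `t = 0`, in the `ℓ¹`-sense. -/
theorem sum_heatKernel_le (hfin : G.IsLocallyFinite) (hstoch : G.IsStochasticallyComplete)
    {t : ℝ} (ht : 0 < t) {x : V} {F : Finset V} (hF : x ∉ F) :
    ∑ y ∈ F, G.heatKernel t x y * G.measure y ≤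
      min 1 (t * ((∑' z, G.weight x z) / G.measure x)) := by
  classical
  have h1 := sum_le_hasSum (insert x F) (fun y _ => mul_nonneg (heatKernel_nonneg hfin ht.le x y)
    (G.measure_pos y).le) (hstoch t ht x)
  rw [Finset.sum_insert hF] at h1
  have h2 := exp_le_heatKernel_mul_measure hfin ht.le x
  have h3 := Real.add_one_le_exp (-(t * ((∑' z, G.weight x z) / G.measure x)))
  have h4 := Real.exp_pos (-(t * ((∑' z, G.weight x z) / G.measure x)))
  exact le_min (by linarith) (by linarith)

/-! ### The kernel of the fractional Laplacian -/

theorem integrableOn_min_mul_rpow {s : ℝ} (hs : s ∈ Set.Ioo (0 : ℝ) 1) {d : ℝ} (hd : 0 ≤ d) :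
    MeasureTheory.IntegrableOn (fun t : ℝ => min 1 (t * d) * t ^ (-1 - s)) (Set.Ioi 0) := by
  have hmeas : Measurable fun t : ℝ => min 1 (t * d) * t ^ (-1 - s) := by fun_prop
  rw [← Set.Ioc_union_Ioi_eq_Ioi zero_le_one]
  refine MeasureTheory.IntegrableOn.union ?_ ?_
  · have h1 : MeasureTheory.IntegrableOn (fun t : ℝ => d * t ^ (-s)) (Set.Ioc 0 1) := by
      have := (intervalIntegral.intervalIntegrable_rpow' (a := 0) (b := 1) (r := -s)
        (by linarith [hs.2])).const_mul d
      rwa [intervalIntegrable_iff_integrableOn_Ioc_of_le zero_le_one] at this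
    refine MeasureTheory.Integrable.mono' h1 hmeas.aestronglyMeasurable ?_
    refine (MeasureTheory.ae_restrict_iff' measurableSet_Ioc).2 (Eventually.of_forall fun t ht => ?_)
    have ht0 : 0 < t := ht.1
    have h2 : t ^ (-s) = t * t ^ (-1 - s) := by
      rw [← Real.rpow_one_add' ht0.le (by linarith [hs.1])]
      congr 1
      ring
    rw [Real.norm_of_nonneg (by positivity), h2]
    have h3 := mul_le_mul_of_nonneg_right (min_le_right 1 (t * d))
      (Real.rpow_nonneg ht0.le (-1 - s))
    linarith
  · have h1 := integrableOn_Ioi_rpow_of_lt (a := -1 - s) (by linarith [hs.1]) zero_lt_one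
    refine MeasureTheory.Integrable.mono' h1 hmeas.aestronglyMeasurable ?_
    refine (MeasureTheory.ae_restrict_iff' measurableSet_Ioi).2 (Eventually.of_forall fun t ht => ?_)
    have ht0 : 0 < t := zero_lt_one.trans ht
    rw [Real.norm_of_nonneg (by positivity)]
    have h3 := mul_le_mul_of_nonneg_right (min_le_left 1 (t * d))
      (Real.rpow_nonneg ht0.le (-1 - s))
    linarith

theorem fracKernel_nonneg (hfin : G.IsLocallyFinite) {s : ℝ} (hs : s ∈ Set.Ioo (0 : ℝ) 1)
    (x y : V) : 0 ≤ G.fracKernel s x y := by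
  unfold fracKernel
  split_ifs
  · exact le_rfl
  · have h1 := Real.Gamma_pos_of_pos (sub_pos.2 hs.2)
    have h2 := G.measure_pos x
    have h3 := G.measure_pos y
    have h4 := hs.1
    refine mul_nonneg (by positivity) (MeasureTheory.setIntegral_nonneg measurableSet_Ioi
      fun t ht => mul_nonneg (heatKernel_nonneg hfin ht.le x y) (Real.rpow_nonneg ht.le _))

variable (G) in
theorem fracKernel_symm (s : ℝ) (x y : V) : G.fracKernel s x y = G.fracKernel s y x := by
  classical
  unfold fracKernel
  rcases eq_or_ne x y with rfl | hxy
  · rfl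
  · simp only [if_neg hxy, if_neg hxy.symm, G.heatKernel_symm _ y x]
    ring

variable (G) in
@[simp]
theorem fracKernel_self (s : ℝ) (x : V) : G.fracKernel s x x = 0 := by
  simp [fracKernel]

/-- The rows of the kernel are summable: `∑ y ≠ x, p(t, x, y) μ y ≤ min 1 (C t)`, and the right hand
side is integrable against `t ^ (-1 - s)`. -/
theorem summable_fracKernel (hfin : G.IsLocallyFinite) (hstoch : G.IsStochasticallyComplete)
    {s : ℝ} (hs : s ∈ Set.Ioo (0 : ℝ) 1) (x : V) : Summable (G.fracKernel s x) := by
  classical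
  set d := (∑' z, G.weight x z) / G.measure x with hd
  have hd0 : 0 ≤ d := div_nonneg (tsum_nonneg (G.weight_nonneg x)) (G.measure_pos x).le
  have hΓ := Real.Gamma_pos_of_pos (sub_pos.2 hs.2)
  have hs0 := hs.1
  have hμx := G.measure_pos x
  refine summable_of_sum_le (c := s / Real.Gamma (1 - s) * G.measure x *
    ∫ t in Set.Ioi (0 : ℝ), min 1 (t * d) * t ^ (-1 - s)) (fracKernel_nonneg hfin hs x) fun F => ?_
  -- The bound needs no measurability of the heat kernel in `t`: where the integrand is not integrable
  -- the Bochner integral, hence the kernel, is `0`, and such `y` can be left out of the sum.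
  set I : V → Prop := fun y => MeasureTheory.IntegrableOn
    (fun t : ℝ => G.heatKernel t x y * t ^ (-1 - s)) (Set.Ioi 0) with hI
  set F' := F.filter fun y => y ≠ x ∧ I y with hF'
  have hsub : ∑ y ∈ F, G.fracKernel s x y = ∑ y ∈ F', G.fracKernel s x y := by
    refine (Finset.sum_subset (Finset.filter_subset _ _) fun y hy hy' => ?_).symm
    rcases eq_or_ne y x with rfl | hyx
    · exact G.fracKernel_self s y
    · have : ¬ I y := fun h => hy' (Finset.mem_filter.2 ⟨hy, hyx, h⟩)
      rw [fracKernel, if_neg hyx.symm, MeasureTheory.integral_undef this, mul_zero]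
  have hx : x ∉ F' := fun h => (Finset.mem_filter.1 h).2.1 rfl
  have heq : ∑ y ∈ F', G.fracKernel s x y = s / Real.Gamma (1 - s) * G.measure x *
      ∫ t in Set.Ioi (0 : ℝ), ∑ y ∈ F', G.measure y * (G.heatKernel t x y * t ^ (-1 - s)) := by
    rw [MeasureTheory.integral_finsetSum _ fun y hy =>
      ((Finset.mem_filter.1 hy).2.2.const_mul (G.measure y)), Finset.mul_sum]
    refine Finset.sum_congr rfl fun y hy => ?_
    rw [MeasureTheory.integral_const_mul, fracKernel, if_neg (Finset.mem_filter.1 hy).2.1.symm]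
    ring
  rw [hsub, heq]
  refine mul_le_mul_of_nonneg_left ?_ (by positivity)
  refine MeasureTheory.setIntegral_mono_on ?_ (integrableOn_min_mul_rpow hs hd0)
    measurableSet_Ioi fun t ht => ?_
  · exact MeasureTheory.integrable_finsetSum _ fun y hy =>
      ((Finset.mem_filter.1 hy).2.2.const_mul (G.measure y))
  · have h1 : ∑ y ∈ F', G.measure y * (G.heatKernel t x y * t ^ (-1 - s)) =
        (∑ y ∈ F', G.heatKernel t x y * G.measure y) * t ^ (-1 - s) := by
      rw [Finset.sum_mul]
      exact Finset.sum_congr rfl fun y _ => by ring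
    rw [h1]
    exact mul_le_mul_of_nonneg_right (sum_heatKernel_le hfin hstoch ht hx)
      (Real.rpow_nonneg ht.le _)

end WeightedGraph

noncomputable section

/-! ### Isometric models of normed spaces -/

/-- A space of functions whose norm is pulled back from a Banach space with Clarkson's inequality
along a linear injection with closed range is a reflexive Banach space. -/
theorem isReflexiveBanachSpace_of_linearMap {S F : Type*} [AddCommGroup S] [Module ℝ S]
    [NormedAddCommGroup F] [NormedSpace ℝ F] [CompleteSpace F] {p : ℝ} (hp : 0 < p)
    (hF : ClarksonIneq F p) {N : S → ℝ} (T : S →ₗ[ℝ] F) (hinj : Function.Injective T)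
    (hclosed : IsClosed (Set.range T)) (hN : ∀ u, N u = ‖T u‖) :
    IsReflexiveBanachSpace S N := by
  unfold IsReflexiveBanachSpace
  let _ : Norm S := ⟨N⟩
  have core : NormedSpace.Core ℝ S :=
    { norm_nonneg := fun u => by
        change 0 ≤ N u
        exact (norm_nonneg _).trans (hN u).ge
      norm_smul := fun c u => by
        change N (c • u) = ‖c‖ * N u
        rw [hN, hN, map_smul, norm_smul]
      norm_triangle := fun u v => by
        change N (u + v) ≤ N u + N v
        rw [hN, hN, hN, map_add]
        exact norm_add_le _ _
      norm_eq_zero_iff := fun u => by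
        change N u = 0 ↔ u = 0
        rw [hN, norm_eq_zero, map_eq_zero_iff T hinj] }
  refine ⟨core, ?_⟩
  let _ : NormedAddCommGroup S := NormedAddCommGroup.ofCore core
  let _ : NormedSpace ℝ S := NormedSpace.ofCore core
  let Ti : S →ₗᵢ[ℝ] F := ⟨T, fun u => (hN u).symm⟩
  have hcomplete : CompleteSpace S :=
    (completeSpace_iff_isComplete_range Ti.isometry.isUniformInducing).2 hclosed.isComplete
  have hUC : UniformConvexSpace S :=
    (hF.of_isometry (T : S →+ F) fun u => (hN u).symm).uniformConvexSpace hp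
  exact ⟨hcomplete, surjective_inclusionInDoubleDual_of_uniformConvexSpace⟩

namespace WeightedGraph

variable {V : Type*} (G : WeightedGraph V)

/-! ### The fractional gradient as a vector -/

/-- The space of bounded functions. -/
def boundedFunctions (V : Type*) : Submodule ℝ (V → ℝ) where
  carrier := {u | ∃ C : ℝ, ∀ x, |u x| ≤ C}
  zero_mem' := ⟨0, by simp⟩
  add_mem' := by
    rintro u v ⟨C, hC⟩ ⟨D, hD⟩
    exact ⟨C + D, fun x => (abs_add_le _ _).trans (add_le_add (hC x) (hD x))⟩
  smul_mem' := by
    rintro c u ⟨C, hC⟩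
    refine ⟨|c| * C, fun x => ?_⟩
    rw [Pi.smul_apply, smul_eq_mul, abs_mul]
    exact mul_le_mul_of_nonneg_left (hC x) (abs_nonneg c)

/-- The kernel `W_s` is nonnegative with summable rows, so that the fractional gradient of every
bounded function exists. -/
def HasSummableKernel (s : ℝ) : Prop :=
  ∀ x, (∀ y, 0 ≤ G.fracKernel s x y) ∧ Summable (G.fracKernel s x)

/-- The component in direction `y` of the fractional gradient of `u` at `x`. Its square, summed
over `y`, is `|∇ˢ u|(x) ^ 2`. -/
def gradCoord (s : ℝ) (x : V) (u : V → ℝ) (y : V) : ℝ :=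
  Real.sqrt (1 / (2 * G.measure x) * G.fracKernel s x y) * (u x - u y)

variable {G} {s : ℝ}

theorem HasSummableKernel.norm_gradCoord_rpow (h : G.HasSummableKernel s) (x : V) (u : V → ℝ)
    (y : V) : ‖G.gradCoord s x u y‖ ^ (2 : ENNReal).toReal =
      1 / (2 * G.measure x) * (G.fracKernel s x y * (u x - u y) ^ 2) := by
  have h1 : 0 ≤ 1 / (2 * G.measure x) * G.fracKernel s x y :=
    mul_nonneg (one_div_nonneg.2 (by linarith [G.measure_pos x])) ((h x).1 y)
  rw [ENNReal.toReal_ofNat, Real.rpow_ofNat, Real.norm_eq_abs, sq_abs, gradCoord, mul_pow,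
    Real.sq_sqrt h1, mul_assoc]

theorem HasSummableKernel.summable_mul_sq (h : G.HasSummableKernel s) {u : V → ℝ}
    (hu : u ∈ boundedFunctions V) (x : V) :
    Summable fun y => G.fracKernel s x y * (u x - u y) ^ 2 := by
  obtain ⟨C, hC⟩ := hu
  refine Summable.of_nonneg_of_le (fun y => mul_nonneg ((h x).1 y) (sq_nonneg _)) (fun y => ?_)
    ((h x).2.mul_right ((2 * C) ^ 2))
  refine mul_le_mul_of_nonneg_left ?_ ((h x).1 y)
  refine sq_le_sq' ?_ ?_ <;> linarith [abs_le.1 (hC x), abs_le.1 (hC y)]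

theorem HasSummableKernel.memℓp_gradCoord (h : G.HasSummableKernel s) {u : V → ℝ}
    (hu : u ∈ boundedFunctions V) (x : V) : Memℓp (G.gradCoord s x u) 2 := by
  refine memℓp_gen ?_
  simp_rw [h.norm_gradCoord_rpow]
  exact (h.summable_mul_sq hu x).mul_left _

/-- The fractional gradient at `x`, as a linear map into `ℓ²(V)`. -/
def HasSummableKernel.gradient (h : G.HasSummableKernel s) (x : V) :
    boundedFunctions V →ₗ[ℝ] lp (fun _ : V => ℝ) 2 where
  toFun u := ⟨G.gradCoord s x u, h.memℓp_gradCoord u.2 x⟩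
  map_add' u v := by
    ext y
    change _ * (((u : V → ℝ) x + (v : V → ℝ) x) - ((u : V → ℝ) y + (v : V → ℝ) y)) =
      _ * ((u : V → ℝ) x - (u : V → ℝ) y) + _ * ((v : V → ℝ) x - (v : V → ℝ) y)
    ring
  map_smul' c u := by
    ext y
    change _ * (c * (u : V → ℝ) x - c * (u : V → ℝ) y) = c * (_ * ((u : V → ℝ) x - (u : V → ℝ) y))
    ring

theorem HasSummableKernel.norm_gradient (h : G.HasSummableKernel s) (x : V)
    (u : boundedFunctions V) : ‖h.gradient x u‖ = G.fracGradLength s u x := by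
  rw [lp.norm_eq_tsum_rpow (by norm_num), fracGradLength, Real.sqrt_eq_rpow, ENNReal.toReal_ofNat]
  congr 1
  rw [← tsum_mul_left]
  exact tsum_congr fun y => h.norm_gradCoord_rpow x u y

variable {p : ℝ}

instance [Fact (2 ≤ p)] : Fact (1 ≤ ENNReal.ofReal p) :=
  ⟨by
    rw [← ENNReal.ofReal_one]
    exact ENNReal.ofReal_le_ofReal (one_le_two.trans (Fact.out : 2 ≤ p))⟩

theorem pos_of_two_le (p : ℝ) [hp : Fact (2 ≤ p)] : 0 < p := two_pos.trans_le hp.out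

theorem toReal_ofReal_of_two_le (p : ℝ) [Fact (2 ≤ p)] : (ENNReal.ofReal p).toReal = p :=
  ENNReal.toReal_ofReal (pos_of_two_le p).le

/-- The fibre `ℓ²(V) ×ₚ ℝ` in which a function takes its gradient and its value. -/
abbrev JetFibre (V : Type*) (p : ℝ) : Type _ :=
  WithLp (ENNReal.ofReal p) (lp (fun _ : V => ℝ) 2 × ℝ)

/-- The model `ℓ^p(V; ℓ²(V) ×ₚ ℝ)` that contains the fractional Sobolev space isometrically. -/
abbrev JetSpace (V : Type*) (p : ℝ) [Fact (2 ≤ p)] : Type _ :=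
  lp (fun _ : V => JetFibre V p) (ENNReal.ofReal p)

theorem clarksonIneq_jetSpace (V : Type*) (p : ℝ) [hp : Fact (2 ≤ p)] :
    ClarksonIneq (JetSpace V p) p := by
  have hq := toReal_ofReal_of_two_le p
  have h0 : 0 < (ENNReal.ofReal p).toReal := hq.symm ▸ pos_of_two_le p
  have h2 : 2 ≤ (ENNReal.ofReal p).toReal := hq.symm ▸ hp.out
  have h : ClarksonIneq (JetSpace V p) (ENNReal.ofReal p).toReal :=
    ClarksonIneq.lp h0 fun _ => ClarksonIneq.withLp h0
      (clarksonIneq_of_innerProductSpace h2) (clarksonIneq_of_innerProductSpace h2)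
  rwa [hq] at h

/-- The pair of gradient and value of a function at `x`, weighted by `μ x ^ (1 / p)`. -/
def HasSummableKernel.jet (h : G.HasSummableKernel s) (p : ℝ) [Fact (2 ≤ p)] (x : V) :
    boundedFunctions V →ₗ[ℝ] JetFibre V p where
  toFun u := G.measure x ^ (1 / p) • WithLp.toLp _ (h.gradient x u, (u : V → ℝ) x)
  map_add' u v := by
    rw [← smul_add, ← WithLp.toLp_add, Prod.mk_add_mk, map_add]
    rfl
  map_smul' c u := by
    rw [RingHom.id_apply, smul_comm c, ← WithLp.toLp_smul, Prod.smul_mk, map_smul]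
    rfl

section Jet

variable [Fact (2 ≤ p)] (h : G.HasSummableKernel s)
include h

theorem HasSummableKernel.jet_fst_apply (x : V) (u : boundedFunctions V) (y : V) :
    (h.jet p x u).fst y = G.measure x ^ (1 / p) * G.gradCoord s x u y := rfl

theorem HasSummableKernel.jet_snd (x : V) (u : boundedFunctions V) :
    (h.jet p x u).snd = G.measure x ^ (1 / p) * (u : V → ℝ) x := rfl

theorem HasSummableKernel.norm_jet_rpow (x : V) (u : boundedFunctions V) :
    ‖h.jet p x u‖ ^ (ENNReal.ofReal p).toReal =
      (G.fracGradLength s u x ^ p + |(u : V → ℝ) x| ^ p) * G.measure x := by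
  have hp := pos_of_two_le p
  have hμ := G.measure_pos x
  have h0 : 0 < (ENNReal.ofReal p).toReal := (toReal_ofReal_of_two_le p).symm ▸ hp
  have h1 : ‖h.jet p x u‖ = G.measure x ^ (1 / p) *
      (G.fracGradLength s u x ^ p + |(u : V → ℝ) x| ^ p) ^ (1 / p) := by
    change ‖G.measure x ^ (1 / p) • WithLp.toLp _ (h.gradient x u, (u : V → ℝ) x)‖ = _
    rw [norm_smul, WithLp.prod_norm_eq_add h0, toReal_ofReal_of_two_le,
      Real.norm_of_nonneg (by positivity)]
    simp only [WithLp.toLp_fst, WithLp.toLp_snd, h.norm_gradient, Real.norm_eq_abs]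
  have hnn : 0 ≤ G.fracGradLength s u x ^ p + |(u : V → ℝ) x| ^ p :=
    add_nonneg (Real.rpow_nonneg (Real.sqrt_nonneg _) _) (Real.rpow_nonneg (abs_nonneg _) _)
  rw [h1, toReal_ofReal_of_two_le, Real.mul_rpow (by positivity) (by positivity),
    ← Real.rpow_mul hμ.le, ← Real.rpow_mul hnn, one_div_mul_cancel hp.ne', Real.rpow_one,
    Real.rpow_one, mul_comm]

theorem HasSummableKernel.memℓp_jet_iff (u : boundedFunctions V) :
    Memℓp (fun x => h.jet p x u) (ENNReal.ofReal p) ↔ (u : V → ℝ) ∈ G.sobolevSpace s p := by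
  have h0 : 0 < (ENNReal.ofReal p).toReal := (toReal_ofReal_of_two_le p).symm ▸ pos_of_two_le p
  rw [memℓp_gen_iff h0]
  simp_rw [h.norm_jet_rpow]
  exact ⟨fun hu => ⟨u.2, hu⟩, fun hu => hu.2⟩

end Jet

/-! ### The fractional Sobolev space as a space of jets -/

/-- The fractional Sobolev space as a linear space. -/
def HasSummableKernel.sobolevSubmodule (h : G.HasSummableKernel s) (p : ℝ) [Fact (2 ≤ p)] :
    Submodule ℝ (V → ℝ) where
  carrier := G.sobolevSpace s p
  zero_mem' := (h.memℓp_jet_iff 0).1 (by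
    simp_rw [map_zero]
    exact zero_mem_ℓp')
  add_mem' := by
    intro u v hu hv
    let u' : boundedFunctions V := ⟨u, hu.1⟩
    let v' : boundedFunctions V := ⟨v, hv.1⟩
    refine (h.memℓp_jet_iff (u' + v')).1 ?_
    simp_rw [map_add]
    exact ((h.memℓp_jet_iff u').2 hu).add ((h.memℓp_jet_iff v').2 hv)
  smul_mem' := by
    intro c u hu
    let u' : boundedFunctions V := ⟨u, hu.1⟩
    refine (h.memℓp_jet_iff (c • u')).1 ?_
    simp_rw [map_smul]
    exact ((h.memℓp_jet_iff u').2 hu).const_smul c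

/-- The isometric embedding of the fractional Sobolev space into the space of jets. -/
def HasSummableKernel.toJet (h : G.HasSummableKernel s) (p : ℝ) [Fact (2 ≤ p)] :
    h.sobolevSubmodule p →ₗ[ℝ] JetSpace V p where
  toFun u := ⟨fun x => h.jet p x ⟨u, u.2.1⟩, (h.memℓp_jet_iff ⟨u, u.2.1⟩).2 u.2⟩
  map_add' u v := by
    ext1
    funext x
    exact map_add (h.jet p x) ⟨u, u.2.1⟩ ⟨v, v.2.1⟩
  map_smul' c u := by
    ext1
    funext x
    exact map_smul (h.jet p x) c ⟨u, u.2.1⟩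

section ToJet

variable [Fact (2 ≤ p)] (h : G.HasSummableKernel s)
include h

theorem HasSummableKernel.toJet_snd (u : h.sobolevSubmodule p) (x : V) :
    (h.toJet p u x).snd = G.measure x ^ (1 / p) * (u : V → ℝ) x := rfl

theorem HasSummableKernel.toJet_fst_apply (u : h.sobolevSubmodule p) (x y : V) :
    (h.toJet p u x).fst y = G.measure x ^ (1 / p) * G.gradCoord s x u y := rfl

theorem HasSummableKernel.norm_toJet (u : h.sobolevSubmodule p) :
    ‖h.toJet p u‖ = G.sobolevNorm s p u := by
  have h0 : 0 < (ENNReal.ofReal p).toReal := (toReal_ofReal_of_two_le p).symm ▸ pos_of_two_le p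
  rw [lp.norm_eq_tsum_rpow h0, sobolevNorm, toReal_ofReal_of_two_le]
  congr 1
  refine tsum_congr fun x => ?_
  rw [← h.norm_jet_rpow x ⟨u, u.2.1⟩, toReal_ofReal_of_two_le]
  rfl

theorem HasSummableKernel.toJet_injective : Function.Injective (h.toJet p) := by
  intro u v huv
  ext x
  have h1 : (h.toJet p u x).snd = (h.toJet p v x).snd := by rw [huv]
  rw [h.toJet_snd, h.toJet_snd] at h1
  exact mul_left_cancel₀ (Real.rpow_pos_of_pos (G.measure_pos x) _).ne' h1

omit h in
theorem continuous_snd_apply (x : V) : Continuous fun g : JetSpace V p => (g x).snd :=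
  ((WithLp.sndL _ ℝ (lp (fun _ : V => ℝ) 2) ℝ).comp
    (lp.evalCLM ℝ (fun _ : V => JetFibre V p) (ENNReal.ofReal p) x)).continuous

omit h in
theorem continuous_fst_apply (x y : V) : Continuous fun g : JetSpace V p => (g x).fst y :=
  ((lp.evalCLM ℝ (fun _ : V => ℝ) 2 y).comp
    ((WithLp.fstL _ ℝ (lp (fun _ : V => ℝ) 2) ℝ).comp
      (lp.evalCLM ℝ (fun _ : V => JetFibre V p) (ENNReal.ofReal p) x))).continuous

theorem HasSummableKernel.tendsto_apply_of_tendsto_toJet {ι : Type*} {l : Filter ι}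
    {u : ι → h.sobolevSubmodule p} {g : JetSpace V p}
    (hu : Tendsto (fun n => h.toJet p (u n)) l (𝓝 g)) (x : V) :
    Tendsto (fun n => (u n : V → ℝ) x) l (𝓝 ((G.measure x ^ (1 / p))⁻¹ * (g x).snd)) := by
  have hμ := (Real.rpow_pos_of_pos (G.measure_pos x) (1 / p)).ne'
  have h1 := (((continuous_snd_apply x).tendsto g).comp hu).const_mul (G.measure x ^ (1 / p))⁻¹
  refine h1.congr fun n => ?_
  rw [Function.comp_apply, h.toJet_snd, inv_mul_cancel_left₀ hμ]

/-- The fractional Sobolev space is complete: limits in the space of jets are again jets of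
functions, since the gradient is determined by the values. The lower bound of the measure makes
the limit function bounded. -/
theorem HasSummableKernel.isClosed_range_toJet (hμ : 0 < ⨅ x, G.measure x) :
    IsClosed (Set.range (h.toJet p)) := by
  have hp := pos_of_two_le p
  refine isClosed_of_closure_subset fun g hg => ?_
  obtain ⟨v, hv, hlim⟩ := mem_closure_iff_seq_limit.1 hg
  choose u hu using hv
  obtain rfl : (fun n => h.toJet p (u n)) = v := funext hu
  set w : V → ℝ := fun x => (G.measure x ^ (1 / p))⁻¹ * (g x).snd with hw
  have hlimw : ∀ x, Tendsto (fun n => (u n : V → ℝ) x) atTop (𝓝 (w x)) :=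
    h.tendsto_apply_of_tendsto_toJet hlim
  have hbdd : w ∈ boundedFunctions V := by
    refine ⟨((⨅ x, G.measure x) ^ (1 / p))⁻¹ * ‖g‖, fun x => ?_⟩
    have h1 : ⨅ x, G.measure x ≤ G.measure x :=
      ciInf_le ⟨0, by rintro _ ⟨y, rfl⟩; exact (G.measure_pos y).le⟩ x
    have h2 : ‖(g x).snd‖ ≤ ‖g‖ :=
      (WithLp.norm_snd_le _ (g x)).trans
        (lp.norm_apply_le_norm (by simpa using hp) g x)
    have h3 := G.measure_pos x
    rw [hw, abs_mul, abs_of_pos (by positivity)]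
    refine mul_le_mul ?_ h2 (abs_nonneg _) (by positivity)
    exact inv_anti₀ (by positivity) (Real.rpow_le_rpow hμ.le h1 (by positivity))
  have hjet : ∀ x, h.jet p x ⟨w, hbdd⟩ = g x := by
    intro x
    have hμx := (Real.rpow_pos_of_pos (G.measure_pos x) (1 / p)).ne'
    refine WithLp.ofLp_injective _ (Prod.ext ?_ ?_)
    · ext y
      change G.measure x ^ (1 / p) * G.gradCoord s x w y = (g x).fst y
      have h1 : Tendsto (fun n => (h.toJet p (u n) x).fst y) atTop (𝓝 ((g x).fst y)) :=
        ((continuous_fst_apply x y).tendsto g).comp hlim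
      refine tendsto_nhds_unique ?_ h1
      exact (((hlimw x).sub (hlimw y)).const_mul _).const_mul _
    · change G.measure x ^ (1 / p) * ((G.measure x ^ (1 / p))⁻¹ * (g x).snd) = (g x).snd
      rw [mul_inv_cancel_left₀ hμx]
  have hmem : w ∈ G.sobolevSpace s p := by
    refine (h.memℓp_jet_iff (p := p) ⟨w, hbdd⟩).1 ?_
    simp_rw [hjet]
    exact lp.memℓp g
  refine ⟨⟨w, hmem⟩, ?_⟩
  ext1
  exact funext hjet

/-! ### Finitely supported functions -/

/-- A finitely supported function lies in the Sobolev space. The gradient of the indicator of `a`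
has `|∇ˢ u|(x) ^ 2 = W_s(x, a) / (2 μ x)` for `x ≠ a`. This is bounded in `x` and, times `μ x`,
summable, by the symmetry of `W_s` and the lower bound of the measure; as `p ≥ 2`, also
`|∇ˢ u| ^ p` is summable. -/
theorem HasSummableKernel.single_mem_sobolevSpace [DecidableEq V]
    (hμ : 0 < ⨅ x, G.measure x) (a : V) :
    Pi.single a (1 : ℝ) ∈ G.sobolevSpace s p := by
  have hp2 : 2 ≤ p := Fact.out
  set m := ⨅ x, G.measure x with hm
  have hmle : ∀ x, m ≤ G.measure x := fun x =>
    ciInf_le ⟨0, by rintro _ ⟨y, rfl⟩; exact (G.measure_pos y).le⟩ x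
  refine ⟨⟨1, fun x => ?_⟩, ?_⟩
  · rcases eq_or_ne x a with rfl | hxa
    · simp
    · simp [hxa]
  set M := ∑' y, G.fracKernel s a y with hM
  refine Summable.of_norm_bounded_eventually
    (g := fun x => (1 / (2 * m) * M) ^ (p / 2 - 1) * (1 / 2 * G.fracKernel s a x))
    (((h a).2.mul_left _).mul_left _) ?_
  filter_upwards [(Set.finite_singleton a).compl_mem_cofinite] with x hx
  have hxa : x ≠ a := hx
  have hμx := G.measure_pos x
  have hKnn := (h a).1 x
  have hKM : G.fracKernel s a x ≤ M := (h a).2.le_tsum x fun y _ => (h a).1 y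
  have hsum : ∑' y, G.fracKernel s x y *
      ((Pi.single a (1 : ℝ) : V → ℝ) x - (Pi.single a (1 : ℝ) : V → ℝ) y) ^ 2 =
      G.fracKernel s a x := by
    rw [tsum_eq_single a fun y hy => by simp [hxa, hy]]
    simp [hxa, G.fracKernel_symm s x a]
  have hz0 : 0 ≤ 1 / (2 * G.measure x) * G.fracKernel s a x := by positivity
  have hzle : 1 / (2 * G.measure x) * G.fracKernel s a x ≤ 1 / (2 * m) * M := by
    refine mul_le_mul ?_ hKM hKnn (by positivity)
    exact one_div_le_one_div_of_le (by positivity) (by linarith [hmle x])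
  have hgrad : G.fracGradLength s (Pi.single a (1 : ℝ)) x ^ p =
      (1 / (2 * G.measure x) * G.fracKernel s a x) ^ (p / 2 - 1) *
        (1 / (2 * G.measure x) * G.fracKernel s a x) := by
    rw [fracGradLength, hsum, Real.sqrt_eq_rpow, ← Real.rpow_mul hz0,
      ← Real.rpow_add_one' hz0 (by linarith)]
    congr 1
    ring
  have hval : |(Pi.single a (1 : ℝ) : V → ℝ) x| ^ p = 0 := by
    rw [Pi.single_eq_of_ne hxa, abs_zero, Real.zero_rpow (by linarith)]
  have hcancel : 1 / (2 * G.measure x) * G.fracKernel s a x * G.measure x =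
      1 / 2 * G.fracKernel s a x := by
    field_simp
  rw [hgrad, hval, add_zero, mul_assoc, hcancel, Real.norm_of_nonneg (by positivity)]
  exact mul_le_mul_of_nonneg_right (Real.rpow_le_rpow hz0 hzle (by linarith)) (by positivity)

theorem HasSummableKernel.mem_sobolevSubmodule_of_finite_support (hμ : 0 < ⨅ x, G.measure x)
    {φ : V → ℝ} (hφ : φ.support.Finite) : φ ∈ h.sobolevSubmodule p := by
  classical
  have hsum : φ = ∑ a ∈ hφ.toFinset, φ a • Pi.single a (1 : ℝ) := by
    ext x
    rw [Finset.sum_apply]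
    simp only [Pi.smul_apply, Pi.single_apply, smul_eq_mul, mul_ite, mul_one, mul_zero,
      Finset.sum_ite_eq, Set.Finite.mem_toFinset, Function.mem_support]
    split_ifs with hx
    · rfl
    · exact not_not.1 hx
  rw [hsum]
  exact Submodule.sum_mem _ fun a _ =>
    Submodule.smul_mem _ _ (h.single_mem_sobolevSpace (p := p) hμ a)

end ToJet

/-- The space of finitely supported functions. -/
def finiteSupportFunctions (V : Type*) : Submodule ℝ (V → ℝ) where
  carrier := {φ | φ.support.Finite}
  zero_mem' := by simp
  add_mem' := fun {φ ψ} hφ hψ =>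
    (Set.Finite.union hφ hψ).subset (Function.support_add φ ψ)
  smul_mem' := fun c φ hφ => Set.Finite.subset hφ (Function.support_const_smul_subset c φ)

/-! ### The closure of the finitely supported functions -/

/-- The closure of the jets of finitely supported functions. -/
def HasSummableKernel.jetClosure (h : G.HasSummableKernel s) (p : ℝ) [Fact (2 ≤ p)] :
    Submodule ℝ (JetSpace V p) :=
  (((finiteSupportFunctions V).comap (h.sobolevSubmodule p).subtype).map
    (h.toJet p)).topologicalClosure

/-- The space `W₀^{s,p}(V)` as a linear space: the functions whose jets are limits of jets of
finitely supported functions. -/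
def HasSummableKernel.sobolevSubmoduleZero (h : G.HasSummableKernel s) (p : ℝ) [Fact (2 ≤ p)] :
    Submodule ℝ (V → ℝ) :=
  ((h.jetClosure p).comap (h.toJet p)).map (h.sobolevSubmodule p).subtype

section Zero

variable [Fact (2 ≤ p)] (h : G.HasSummableKernel s)
include h

theorem HasSummableKernel.isClosed_jetClosure : IsClosed (h.jetClosure p : Set (JetSpace V p)) :=
  Submodule.isClosed_topologicalClosure _

theorem HasSummableKernel.toJet_mem_jetClosure (u : h.sobolevSubmodule p)
    (hu : (u : V → ℝ).support.Finite) : h.toJet p u ∈ h.jetClosure p :=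
  Submodule.le_topologicalClosure _ ⟨u, hu, rfl⟩

theorem HasSummableKernel.exists_seq_of_toJet_mem_jetClosure {u : h.sobolevSubmodule p}
    (hu : h.toJet p u ∈ h.jetClosure p) :
    ∃ φ : ℕ → h.sobolevSubmodule p, (∀ n, (φ n : V → ℝ).support.Finite) ∧
      Tendsto (fun n => h.toJet p (φ n)) atTop (𝓝 (h.toJet p u)) := by
  obtain ⟨v, hv, hlim⟩ := mem_closure_iff_seq_limit.1 hu
  choose φ hφ hφv using hv
  obtain rfl : (fun n => h.toJet p (φ n)) = v := funext hφv
  exact ⟨φ, hφ, hlim⟩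

theorem HasSummableKernel.jetClosure_le_range (hμ : 0 < ⨅ x, G.measure x) {g : JetSpace V p}
    (hg : g ∈ h.jetClosure p) : ∃ u, h.toJet p u = g := by
  refine closure_minimal ?_ (h.isClosed_range_toJet hμ) hg
  rintro _ ⟨u, -, rfl⟩
  exact ⟨u, rfl⟩

theorem HasSummableKernel.tendsto_sobolevNorm_iff {φ : ℕ → h.sobolevSubmodule p}
    {u : h.sobolevSubmodule p} :
    Tendsto (fun n => G.sobolevNorm s p ((φ n : V → ℝ) - u)) atTop (𝓝 0) ↔
      Tendsto (fun n => h.toJet p (φ n)) atTop (𝓝 (h.toJet p u)) := by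
  rw [tendsto_iff_norm_sub_tendsto_zero (b := h.toJet p u)]
  refine tendsto_congr fun n => ?_
  rw [← map_sub, h.norm_toJet]
  rfl

theorem HasSummableKernel.coe_sobolevSubmoduleZero (hμ : 0 < ⨅ x, G.measure x) :
    (h.sobolevSubmoduleZero p : Set (V → ℝ)) = G.sobolevSpaceZero s p := by
  ext u
  constructor
  · rintro ⟨u, hu, rfl⟩
    obtain ⟨φ, hφ, hlim⟩ := h.exists_seq_of_toJet_mem_jetClosure hu
    exact ⟨u.2, fun n => φ n, hφ, h.tendsto_sobolevNorm_iff.2 hlim⟩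
  · rintro ⟨hu, φ, hφ, hlim⟩
    let φ' : ℕ → h.sobolevSubmodule p := fun n =>
      ⟨φ n, h.mem_sobolevSubmodule_of_finite_support hμ (hφ n)⟩
    refine ⟨⟨u, hu⟩, ?_, rfl⟩
    exact h.isClosed_jetClosure.mem_of_tendsto
      ((h.tendsto_sobolevNorm_iff (φ := φ') (u := ⟨u, hu⟩)).1 hlim)
      (Eventually.of_forall fun n => h.toJet_mem_jetClosure (φ' n) (hφ n))

theorem HasSummableKernel.isReflexiveBanachSpace_sobolevSubmoduleZero
    (hμ : 0 < ⨅ x, G.measure x) :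
    IsReflexiveBanachSpace (h.sobolevSubmoduleZero p)
      fun u => G.sobolevNorm s p (u : V → ℝ) := by
  have hle : h.sobolevSubmoduleZero p ≤ h.sobolevSubmodule p := Submodule.map_subtype_le _ _
  refine isReflexiveBanachSpace_of_linearMap (pos_of_two_le p) (clarksonIneq_jetSpace V p)
    ((h.toJet p).comp (Submodule.inclusion hle))
    (h.toJet_injective.comp (Submodule.inclusion_injective hle)) ?_
    fun u => (h.norm_toJet (Submodule.inclusion hle u)).symm
  convert h.isClosed_jetClosure (p := p)
  ext g
  constructor
  · rintro ⟨⟨_, ⟨u, hu, rfl⟩⟩, rfl⟩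
    exact hu
  · intro hg
    obtain ⟨u, rfl⟩ := h.jetClosure_le_range hμ hg
    exact ⟨⟨u, ⟨u, hg, rfl⟩⟩, rfl⟩

/-! ### Contractions operate on the Sobolev space -/

omit [Fact (2 ≤ p)] in
theorem HasSummableKernel.fracGradLength_comp_le {ψ : ℝ → ℝ}
    (hψ : ∀ a b, |ψ a - ψ b| ≤ |a - b|) {u : V → ℝ} (hu : u ∈ boundedFunctions V)
    (hψu : (fun x => ψ (u x)) ∈ boundedFunctions V) (x : V) :
    G.fracGradLength s (fun x => ψ (u x)) x ≤ G.fracGradLength s u x := by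
  refine Real.sqrt_le_sqrt (mul_le_mul_of_nonneg_left ?_
    (one_div_nonneg.2 (by linarith [G.measure_pos x])))
  exact (h.summable_mul_sq hψu x).tsum_le_tsum
    (fun y => mul_le_mul_of_nonneg_left (sq_le_sq.2 (hψ _ _)) ((h x).1 y)) (h.summable_mul_sq hu x)

theorem HasSummableKernel.comp_mem_sobolevSpace {ψ : ℝ → ℝ} (hψ0 : ψ 0 = 0)
    (hψ : ∀ a b, |ψ a - ψ b| ≤ |a - b|) {u : V → ℝ} (hu : u ∈ G.sobolevSpace s p) :
    (fun x => ψ (u x)) ∈ G.sobolevSpace s p ∧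
      G.sobolevNorm s p (fun x => ψ (u x)) ≤ G.sobolevNorm s p u := by
  have hp := pos_of_two_le p
  have habs : ∀ a, |ψ a| ≤ |a| := fun a => by simpa [hψ0] using hψ a 0
  have hb : (fun x => ψ (u x)) ∈ boundedFunctions V := by
    obtain ⟨C, hC⟩ := hu.1
    exact ⟨C, fun x => (habs _).trans (hC x)⟩
  have hnn : ∀ (v : V → ℝ) (x : V),
      0 ≤ (G.fracGradLength s v x ^ p + |v x| ^ p) * G.measure x := fun v x =>
    mul_nonneg (add_nonneg (Real.rpow_nonneg (Real.sqrt_nonneg _) _)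
      (Real.rpow_nonneg (abs_nonneg _) _)) (G.measure_pos x).le
  have hle : ∀ x, (G.fracGradLength s (fun x => ψ (u x)) x ^ p + |ψ (u x)| ^ p) * G.measure x ≤
      (G.fracGradLength s u x ^ p + |u x| ^ p) * G.measure x := fun x =>
    mul_le_mul_of_nonneg_right (add_le_add
      (Real.rpow_le_rpow (Real.sqrt_nonneg _) (h.fracGradLength_comp_le hψ hu.1 hb x) hp.le)
      (Real.rpow_le_rpow (abs_nonneg _) (habs _) hp.le)) (G.measure_pos x).le
  have hsum := Summable.of_nonneg_of_le (hnn fun x => ψ (u x)) hle hu.2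
  exact ⟨⟨hb, hsum⟩, Real.rpow_le_rpow (tsum_nonneg (hnn fun x => ψ (u x)))
    (hsum.tsum_le_tsum hle hu.2) (by positivity)⟩

/-- A contraction `ψ` with `ψ 0 = 0` operates on `W₀^{s,p}(V)`. If `φ n → u` with `φ n` finitely
supported, then `ψ ∘ φ n` is bounded in the reflexive space `W₀^{s,p}(V)`, so that it has a weak
limit there. As point evaluations are continuous, this limit is `ψ ∘ u`. -/
theorem HasSummableKernel.comp_mem_sobolevSpaceZero (hμ : 0 < ⨅ x, G.measure x) {ψ : ℝ → ℝ}
    (hψ0 : ψ 0 = 0) (hψ : ∀ a b, |ψ a - ψ b| ≤ |a - b|) {u : V → ℝ}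
    (hu : u ∈ G.sobolevSpaceZero s p) : (fun x => ψ (u x)) ∈ G.sobolevSpaceZero s p := by
  rw [← h.coe_sobolevSubmoduleZero hμ] at hu ⊢
  obtain ⟨u, hu, rfl⟩ := hu
  obtain ⟨φ, hφ, hlim⟩ := h.exists_seq_of_toJet_mem_jetClosure hu
  have hφlim : ∀ x, Tendsto (fun n => (φ n : V → ℝ) x) atTop (𝓝 ((u : V → ℝ) x)) := by
    intro x
    have h1 := h.tendsto_apply_of_tendsto_toJet hlim x
    rwa [h.toJet_snd, inv_mul_cancel_left₀
      (Real.rpow_pos_of_pos (G.measure_pos x) (1 / p)).ne'] at h1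
  have hψcont : Continuous ψ := (LipschitzWith.of_dist_le_mul (K := 1) fun a b => by
    simpa [Real.dist_eq] using hψ a b).continuous
  have hψφ := fun n => h.comp_mem_sobolevSpace hψ0 hψ (φ n).2
  let ψφ : ℕ → h.sobolevSubmodule p := fun n => ⟨fun x => ψ ((φ n : V → ℝ) x), (hψφ n).1⟩
  have hψφfin : ∀ n, (ψφ n : V → ℝ).support.Finite := fun n =>
    (hφ n).subset fun x hx hx0 => hx (by
      change ψ ((φ n : V → ℝ) x) = 0
      rw [hx0, hψ0])
  let v : ℕ → h.jetClosure p := fun n =>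
    ⟨h.toJet p (ψφ n), h.toJet_mem_jetClosure (ψφ n) (hψφfin n)⟩
  obtain ⟨C, hC⟩ := hlim.norm.bddAbove_range
  have hv : ∀ n, ‖v n‖ ≤ C := by
    intro n
    change ‖h.toJet p (ψφ n)‖ ≤ C
    rw [h.norm_toJet]
    refine (hψφ n).2.trans ?_
    rw [← h.norm_toJet]
    exact hC ⟨n, rfl⟩
  have : CompleteSpace (h.jetClosure p) := h.isClosed_jetClosure.completeSpace_coe
  have : UniformConvexSpace (h.jetClosure p) :=
    ((clarksonIneq_jetSpace V p).of_isometry ((h.jetClosure p).subtype : _ →+ JetSpace V p)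
      fun _ => rfl).uniformConvexSpace (pos_of_two_le p)
  obtain ⟨w, 𝒰, h𝒰, hw⟩ := exists_ultrafilter_tendsto_of_reflexive
    surjective_inclusionInDoubleDual_of_uniformConvexSpace hv
  obtain ⟨u', hu'⟩ := h.jetClosure_le_range hμ w.2
  refine ⟨u', ?_, ?_⟩
  · change h.toJet p u' ∈ h.jetClosure p
    rw [hu']
    exact w.2
  · funext x
    let ev : StrongDual ℝ (h.jetClosure p) :=
      ((WithLp.sndL _ ℝ (lp (fun _ : V => ℝ) 2) ℝ).comp
        (lp.evalCLM ℝ (fun _ : V => JetFibre V p) (ENNReal.ofReal p) x)).comp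
          (h.jetClosure p).subtypeL
    have h1 : Tendsto (fun n => G.measure x ^ (1 / p) * ψ ((φ n : V → ℝ) x)) 𝒰
        (𝓝 (((w : JetSpace V p) x).snd)) := hw ev
    have h2 : Tendsto (fun n => G.measure x ^ (1 / p) * ψ ((φ n : V → ℝ) x)) 𝒰
        (𝓝 (G.measure x ^ (1 / p) * ψ ((u : V → ℝ) x))) :=
      (((hψcont.tendsto _).comp (hφlim x)).const_mul _).mono_left h𝒰
    have h3 := tendsto_nhds_unique h1 h2
    rw [← hu', h.toJet_snd] at h3
    exact mul_left_cancel₀ (Real.rpow_pos_of_pos (G.measure_pos x) _).ne' h3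

end Zero

end WeightedGraph

end

theorem mainTheorem2 {V : Type*} (G : WeightedGraph V)
    (hconn : G.graph.Connected) (hfin : G.IsLocallyFinite)
    (hstoch : G.IsStochasticallyComplete)
    (hμ : 0 < ⨅ x, G.measure x)
    (s p : ℝ) (hs : s ∈ Set.Ioo (0 : ℝ) 1) (hp : 2 ≤ p) :
    (∀ φ : V → ℝ, φ.support.Finite → φ ∈ G.sobolevSpaceZero s p) ∧
    (∃ S : Submodule ℝ (V → ℝ), (S : Set (V → ℝ)) = G.sobolevSpaceZero s p ∧
      IsReflexiveBanachSpace S (fun u => G.sobolevNorm s p (u : V → ℝ))) ∧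
    (∀ u ∈ G.sobolevSpaceZero s p,
      (fun x => max (u x) 0) ∈ G.sobolevSpaceZero s p ∧
      (fun x => min (u x) 0) ∈ G.sobolevSpaceZero s p ∧
      (fun x => |u x|) ∈ G.sobolevSpaceZero s p) := by
  have : Fact (2 ≤ p) := ⟨hp⟩
  have h : G.HasSummableKernel s := fun x =>
    ⟨WeightedGraph.fracKernel_nonneg hfin hs x, WeightedGraph.summable_fracKernel hfin hstoch hs x⟩
  refine ⟨fun φ hφ => ?_, ⟨h.sobolevSubmoduleZero p, h.coe_sobolevSubmoduleZero hμ,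
    h.isReflexiveBanachSpace_sobolevSubmoduleZero hμ⟩, fun u hu => ⟨?_, ?_, ?_⟩⟩
  · rw [← h.coe_sobolevSubmoduleZero hμ]
    let φ' : h.sobolevSubmodule p := ⟨φ, h.mem_sobolevSubmodule_of_finite_support hμ hφ⟩
    exact ⟨φ', h.toJet_mem_jetClosure φ' hφ, rfl⟩
  · exact h.comp_mem_sobolevSpaceZero hμ (ψ := fun a => max a 0) (max_self 0)
      (fun a b => abs_max_sub_max_le_abs a b 0) hu
  · exact h.comp_mem_sobolevSpaceZero hμ (ψ := fun a => min a 0) (min_self 0)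
      (fun a b => by simpa using abs_min_sub_min_le_max a 0 b 0) hu
  · exact h.comp_mem_sobolevSpaceZero hμ (ψ := fun a => |a|) abs_zero
      (fun a b => abs_abs_sub_abs_le_abs_sub a b) hu
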